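/- Let $n\ge 1$ and let $J$ be a countable set. For each $j\in J$, let $m_j$ be a positive integer, let $P_j:\mathbb{R}^{nm_j}\to\mathbb{R}$ be a polynomial in $nm_j$ variables with rational coefficients that is not identically zero, and let $\Phi_{j,1},\ldots,\Phi_{j,m_j}$ be $C^1$ diffeomorphisms of $\mathbb{R}^n$ onto itself. Assume that the degrees of the polynomials $P_j$ ($j\in J$) have a maximum $d$, and that $d\ge 1$. Then there exists a compact set $E\subset\mathbb{R}^n$ of Hausdorff dimension $n/d$ such that for every $j\in J$, $E$ does not contain $m_j$ distinct points $x_1,\ldots,x_{m_j}$ satisfying $$P_j\bigl(\Phi_{j,1}(x_1),\ldots,\Phi_{j,m_j}(x_{m_j})\bigr)=0,$$ where $P_j(y_1,\ldots,y_{m_j})$, for $y_i=(y_{i,1},\ldots,y_{i,n})\in\mathbb{R}^n$, means $P_j(y_{1,1},\ldots,y_{1,n},\ldots,y_{m_j,1},\ldots,y_{m_j,n})$. -/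

import Mathlib

open scoped Manifold ENNReal ContDiff

/-! A rational polynomial `R` of degree at most `d` takes values in `(1/(b N^d))ℤ` on the lattice
`(1/N)ℤ^σ`, with `b` independent of `N`. Translate the lattice by `θ/N^d` in one coordinate `v`.
Where `∂R/∂v ≠ 0`, this changes the value by about `θ (∂R/∂v)/N^d`, which for small `θ` is nonzero
but shorter than one step `1/(b N^d)`. Hence `R` has no zero within `c/N^d` of the translated
lattice (`exists_shift_aeval_ne_zero`). Balls of radius about `N^{-d}` at spacing about `1/N` are
what a Cantor set of dimension `n/d` needs, if `N` grows fast enough from stage to stage.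

A zero of `P j` where all first derivatives vanish is a zero of a derivative, so descending in
degree reaches some `R` with a nonvanishing derivative there (`exists_aeval_pderiv_ne_zero`).
Distinct points lie in separated small balls, so each coordinate `x i` can have its own
diffeomorphism and its own translate: the lattice is pulled back by `Φ i` near the `i`-th ball
(`achievable_of_lattice`). Rational polynomials, directions and balls from a countable family
suffice, and one such datum is treated per stage (`exists_compact_of_achievable`). The dimension is
bounded above by counting balls and below by a Hölder decoding map onto a cube. -/

namespace MvPolynomial

/-! ### Derivatives and denominators of rational polynomials -/

section Degree

variable {σ : Type*}

theorem coeff_add_single_ne_zero_of_mem_support_pderiv {R : MvPolynomial σ ℚ} {v : σ} {s : σ →₀ ℕ}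
    (hs : s ∈ (pderiv v R).support) : s + Finsupp.single v 1 ∈ R.support := by
  rw [mem_support_iff, coeff_pderiv] at hs
  rw [mem_support_iff]
  exact left_ne_zero_of_mul hs

theorem totalDegree_pderiv_add_one_le {R : MvPolynomial σ ℚ} {v : σ} (h : pderiv v R ≠ 0) :
    (pderiv v R).totalDegree + 1 ≤ R.totalDegree := by
  have key : ∀ s ∈ (pderiv v R).support, (s.sum fun _ e => e) + 1 ≤ R.totalDegree := by
    intro s hs
    have := le_totalDegree (coeff_add_single_ne_zero_of_mem_support_pderiv hs)
    rw [Finsupp.sum_add_index' (by simp) (by simp)] at this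
    simpa using this
  obtain ⟨s₀, hs₀⟩ := support_nonempty.mpr h
  have h1 : 1 ≤ R.totalDegree := le_trans (Nat.le_add_left _ _) (key s₀ hs₀)
  have : (pderiv v R).totalDegree ≤ R.totalDegree - 1 :=
    Finset.sup_le fun s hs => by have := key s hs; omega
  omega

/-- Characteristic zero: a monomial containing `v` contributes its coefficient times a nonzero
integer, and no other monomial contributes to the same exponent. -/
theorem exists_pderiv_ne_zero {R : MvPolynomial σ ℚ} (hR : R.totalDegree ≠ 0) :
    ∃ v, pderiv v R ≠ 0 := by
  classical
  obtain ⟨s, hs, hs0⟩ : ∃ s ∈ R.support, s ≠ 0 := by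
    by_contra! hcon
    refine hR (Nat.le_zero.mp (Finset.sup_le fun s hs => ?_))
    simp [hcon s hs]
  obtain ⟨v, hv⟩ := Finsupp.ne_iff.mp hs0
  refine ⟨v, fun h0 => ?_⟩
  have hle : Finsupp.single v 1 ≤ s := by
    rw [Finsupp.single_le_iff]
    exact Nat.one_le_iff_ne_zero.mpr hv
  have hc := coeff_pderiv (i := v) R (s - Finsupp.single v 1)
  rw [h0, coeff_zero, tsub_add_cancel_of_le hle] at hc
  rcases mul_eq_zero.mp hc.symm with h | h
  · exact mem_support_iff.mp hs h
  · exact (Nat.cast_add_one_pos (α := ℚ) ((s - Finsupp.single v 1 : σ →₀ ℕ) v)).ne' h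

/-- A zero of a nonzero polynomial is a zero of a polynomial of no larger degree having a
nonvanishing partial derivative there. -/
theorem exists_aeval_pderiv_ne_zero (y : σ → ℝ) :
    ∀ (k : ℕ) (R : MvPolynomial σ ℚ), R.totalDegree ≤ k → R ≠ 0 → aeval y R = 0 →
      ∃ (R' : MvPolynomial σ ℚ) (v : σ), R'.totalDegree ≤ k ∧ aeval y R' = 0 ∧
        aeval y (pderiv v R') ≠ 0 := by
  have const : ∀ R : MvPolynomial σ ℚ, R ≠ 0 → aeval y R = 0 → R.totalDegree ≠ 0 := by
    intro R hR h0 hd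
    rw [totalDegree_eq_zero_iff_eq_C] at hd
    rw [hd, aeval_C, map_eq_zero_iff _ (algebraMap ℚ ℝ).injective] at h0
    exact hR (by rw [hd, h0, C_0])
  intro k
  induction k with
  | zero => exact fun R hd hR h0 => absurd (Nat.le_zero.mp hd) (const R hR h0)
  | succ k ih =>
    intro R hd hR h0
    obtain ⟨v, hv⟩ := exists_pderiv_ne_zero (const R hR h0)
    by_cases hv0 : aeval y (pderiv v R) = 0
    · have := totalDegree_pderiv_add_one_le hv
      obtain ⟨R', w, h1, h2, h3⟩ := ih _ (by omega) hv hv0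
      exact ⟨R', w, by omega, h2, h3⟩
    · exact ⟨R, v, hd, h0, hv0⟩

/-- Values of a rational polynomial of degree at most `d` at points of `(1/N)ℤ^σ` are integer
multiples of a fixed fraction of `N^{-d}`. -/
theorem exists_denominator (R : MvPolynomial σ ℚ) {d : ℕ} (hd : R.totalDegree ≤ d) :
    ∃ b : ℕ, 0 < b ∧ ∀ (N : ℕ) (z : σ → ℤ), 0 < N →
      ∃ k : ℤ, (b : ℝ) * N ^ d * aeval (fun v => (z v : ℝ) / N) R = k := by
  classical
  refine ⟨∏ s ∈ R.support, (R.coeff s).den, Finset.prod_pos fun s _ => (R.coeff s).den_pos, ?_⟩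
  intro N z hN
  have hN' : (N : ℝ) ≠ 0 := by positivity
  have term : ∀ s ∈ R.support, ∃ k : ℤ,
      ((∏ s ∈ R.support, (R.coeff s).den : ℕ) : ℝ) * N ^ d *
        (((R.coeff s : ℚ) : ℝ) * ∏ v ∈ s.support, ((z v : ℝ) / N) ^ s v) = k := by
    intro s hs
    have hdeg : (∑ v ∈ s.support, s v) ≤ d := (le_totalDegree hs).trans hd
    -- The monomial uses up `N ^ (d - e)` of the factor `N ^ d`; the surplus `N ^ e` is an integer.
    obtain ⟨e, he⟩ := Nat.exists_eq_add_of_le hdeg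
    obtain ⟨q, hq⟩ := Finset.dvd_prod_of_mem (fun s => (R.coeff s).den) hs
    refine ⟨q * (R.coeff s).num * N ^ e * ∏ v ∈ s.support, z v ^ s v, ?_⟩
    have hden : ((R.coeff s).den : ℝ) * ((R.coeff s : ℚ) : ℝ) = (R.coeff s).num := by
      have := Rat.den_mul_eq_num (R.coeff s)
      exact_mod_cast this
    simp only [div_pow, Finset.prod_div_distrib, Finset.prod_pow_eq_pow_sum]
    rw [hq, he]
    push_cast
    rw [← hden, pow_add]
    field_simp
  choose! k hk using term
  refine ⟨∑ s ∈ R.support, k s, ?_⟩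
  rw [aeval_def, eval₂_eq, Finset.mul_sum, Int.cast_sum]
  exact Finset.sum_congr rfl fun s hs => hk s hs

end Degree

/-! ### No zeros near a translated lattice -/

section Calculus

variable {σ : Type*} [Fintype σ]

omit [Fintype σ] in
theorem continuous_aeval_real (R : MvPolynomial σ ℚ) :
    Continuous fun y : σ → ℝ => aeval y R := by
  have : (fun y : σ → ℝ => aeval y R) = fun y => eval y (map (algebraMap ℚ ℝ) R) := by
    funext y
    rw [eval_map, aeval_def]
  rw [this]
  exact continuous_eval _

theorem hasDerivAt_aeval_line (R : MvPolynomial σ ℚ) (z w : σ → ℝ) (t : ℝ) :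
    HasDerivAt (fun t : ℝ => aeval (fun v => z v + t * w v) R)
      (∑ v, w v * aeval (fun v => z v + t * w v) (pderiv v R)) t := by
  classical
  induction R using MvPolynomial.induction_on with
  | C a => simpa using hasDerivAt_const t _
  | add p q hp hq =>
    simp only [map_add, mul_add, Finset.sum_add_distrib]
    exact hp.add hq
  | mul_X p u hp =>
    have hx : HasDerivAt (fun t : ℝ => z u + t * w u) (w u) t := by
      simpa using ((hasDerivAt_id t).mul_const (w u)).const_add (z u)
    have := hp.mul hx
    simp only [map_mul, aeval_X]
    refine this.congr_deriv ?_
    simp only [Derivation.leibniz, pderiv_X, smul_eq_mul, map_add, map_mul, aeval_X,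
      mul_add (w _), Finset.sum_add_distrib, Finset.sum_mul]
    rw [add_comm]
    congr 1
    · rw [Finset.sum_eq_single u]
      · simp [mul_comm]
      · intro b _ hb
        simp [hb.symm]
      · simp
    · exact Finset.sum_congr rfl fun v _ => by ring

theorem exists_aeval_sub_eq (R : MvPolynomial σ ℚ) (z w : σ → ℝ) :
    ∃ t ∈ Set.Ioo (0 : ℝ) 1, aeval (fun v => z v + w v) R - aeval z R =
      ∑ v, w v * aeval (fun v => z v + t * w v) (pderiv v R) := by
  obtain ⟨t, ht, h⟩ := exists_hasDerivAt_eq_slope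
    (fun t : ℝ => aeval (fun v => z v + t * w v) R) _ zero_lt_one
    (fun t _ => (hasDerivAt_aeval_line R z w t).continuousAt.continuousWithinAt)
    (fun t _ => hasDerivAt_aeval_line R z w t)
  refine ⟨t, ht, ?_⟩
  rw [h]
  simp

/-- If `∂R/∂v₀` does not vanish on a compact set `K`, then `R` has no zeros `y ∈ K` which are close
to a suitable translate of the lattice `(1/N)ℤ^σ` in the direction `v₀`. -/
theorem exists_shift_aeval_ne_zero [DecidableEq σ] (R : MvPolynomial σ ℚ) {d : ℕ} (hd1 : 1 ≤ d)
    (hd : R.totalDegree ≤ d) (v₀ : σ) {K : Set (σ → ℝ)} (hK : IsCompact K)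
    (hne : ∀ y ∈ K, aeval y (pderiv v₀ R) ≠ 0) :
    ∃ θ c : ℝ, 0 < θ ∧ θ ≤ 1 ∧ 0 < c ∧ ∃ N₀ : ℕ, ∀ N : ℕ, N₀ ≤ N → ∀ y ∈ K, ∀ z : σ → ℤ,
      (∀ v, |y v - ((z v : ℝ) / N + (if v = v₀ then θ else 0) / N ^ d)| ≤ c / N ^ d) →
      aeval y R ≠ 0 := by
  rcases K.eq_empty_or_nonempty with rfl | ⟨y₀, hy₀⟩
  · exact ⟨1, 1, one_pos, le_rfl, one_pos, 0, by simp⟩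
  obtain ⟨b, hb, hint⟩ := exists_denominator R hd
  obtain ⟨η, hη, hsub⟩ := hK.exists_cthickening_subset_open
    (isOpen_ne_fun (continuous_aeval_real (pderiv v₀ R)) continuous_const) hne
  set K' := Metric.cthickening η K
  have hK' : IsCompact K' := hK.cthickening
  have hKK' : K ⊆ K' := Metric.self_subset_cthickening K
  obtain ⟨δ, hδ, hδK⟩ : ∃ δ > 0, ∀ y ∈ K', δ ≤ |aeval y (pderiv v₀ R)| := by
    obtain ⟨x, hx, hmin⟩ := hK'.exists_isMinOn ⟨y₀, hKK' hy₀⟩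
      (continuous_aeval_real (pderiv v₀ R)).abs.continuousOn
    exact ⟨_, abs_pos.mpr (hsub hx), fun y hy => hmin hy⟩
  obtain ⟨B, hB⟩ : ∃ B, ∀ y ∈ K', ∑ v, |aeval y (pderiv v R)| ≤ B := by
    obtain ⟨B, hB⟩ := hK'.bddAbove_image (f := fun y : σ → ℝ => ∑ v, |aeval y (pderiv v R)|)
      (continuous_finsetSum _ fun v _ => (continuous_aeval_real _).abs).continuousOn
    exact ⟨B, fun y hy => hB ⟨y, hy, rfl⟩⟩
  have hBv : ∀ y ∈ K', ∀ v, |aeval y (pderiv v R)| ≤ B := fun y hy v =>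
    (Finset.single_le_sum (f := fun v => |aeval y (pderiv v R)|) (fun _ _ => abs_nonneg _)
      (Finset.mem_univ v)).trans (hB y hy)
  have hδB : δ ≤ B := (hδK _ (hKK' hy₀)).trans (hBv _ (hKK' hy₀) v₀)
  have hBpos : 0 < B := hδ.trans_le hδB
  have hbpos : (1 : ℝ) ≤ b := by exact_mod_cast hb
  -- `θ` is small enough that the shift moves `b N^d R` by at most `1/4`; `c` below makes the
  -- remaining error at most half of the smallest shift effect `θ δ`.
  set θ : ℝ := 1 / (4 * b * (B + 1)) with hθ
  have hθ0 : 0 < θ := by positivity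
  have hθ1 : θ ≤ 1 := by
    rw [hθ, div_le_one (by positivity)]
    nlinarith
  have hθB : b * θ * B ≤ 1 / 4 := by
    rw [hθ]
    field_simp
    linarith
  set c : ℝ := θ * δ / (2 * B) with hc
  have hc0 : 0 < c := by positivity
  have hcB : c * B = θ * δ / 2 := by rw [hc]; field_simp
  obtain ⟨N₀, hN₀⟩ := exists_nat_gt ((θ + c) / η)
  refine ⟨θ, c, hθ0, hθ1, hc0, N₀ + 1, ?_⟩
  intro N hN y hy z hz h0
  have hNpos : 0 < N := by omega
  have hN1 : (1 : ℝ) ≤ N := by exact_mod_cast hNpos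
  have hNd : (0 : ℝ) < (N : ℝ) ^ d := by positivity
  have hNη : (θ + c) / N ^ d ≤ η := by
    rw [div_le_iff₀ hNd]
    rw [div_lt_iff₀ hη] at hN₀
    have h1 : (N₀ : ℝ) ≤ N := by exact_mod_cast (by omega : N₀ ≤ N)
    have h2 : (N : ℝ) ≤ N ^ d := le_self_pow₀ hN1 (by omega)
    nlinarith
  set x : σ → ℝ := fun v => (z v : ℝ) / N
  set e : σ → ℝ := fun v => if v = v₀ then θ else 0
  obtain ⟨t, ht, hmv⟩ := exists_aeval_sub_eq R x (fun v => y v - x v)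
  set ξ : σ → ℝ := fun v => x v + t * (y v - x v)
  have hyx : ∀ v, |y v - x v| ≤ (θ + c) / N ^ d := by
    intro v
    have he : |e v / N ^ d| ≤ θ / N ^ d := by
      rw [abs_div, abs_of_pos hNd]
      gcongr
      simp only [e]
      split_ifs
      · exact (abs_of_pos hθ0).le
      · simpa using hθ0.le
    have : y v - x v = (y v - (x v + e v / N ^ d)) + e v / N ^ d := by ring
    rw [this, add_div, add_comm (θ / _)]
    exact (abs_add_le _ _).trans (add_le_add (hz v) he)
  have hξ : ξ ∈ K' := by
    refine Metric.mem_cthickening_of_dist_le ξ y η K hy ?_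
    rw [dist_pi_le_iff hη.le]
    intro v
    have : ξ v - y v = -((1 - t) * (y v - x v)) := by simp only [ξ]; ring
    rw [Real.dist_eq, this, abs_neg, abs_mul, abs_of_pos (by linarith [ht.2])]
    have := hyx v
    nlinarith [abs_nonneg (y v - x v), ht.1, ht.2]
  have hxy : (fun v => x v + (y v - x v)) = y := by funext v; ring
  rw [hxy, h0, zero_sub] at hmv
  set D := fun v => aeval ξ (pderiv v R) with hD
  have hsplit : N ^ d * ∑ v, (y v - x v) * D v =
      θ * D v₀ + ∑ v, N ^ d * (y v - (x v + e v / N ^ d)) * D v := by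
    have h1 : θ * D v₀ = ∑ v, e v * D v := by simp [e]
    rw [h1, Finset.mul_sum, ← Finset.sum_add_distrib]
    refine Finset.sum_congr rfl fun v _ => ?_
    field_simp
    ring
  have herr : |∑ v, N ^ d * (y v - (x v + e v / N ^ d)) * D v| ≤ θ * δ / 2 := by
    calc _ ≤ ∑ v, |N ^ d * (y v - (x v + e v / N ^ d)) * D v| := Finset.abs_sum_le_sum_abs _ _
      _ ≤ ∑ v, c * |D v| := by
        refine Finset.sum_le_sum fun v _ => ?_
        rw [abs_mul, abs_mul, abs_of_pos hNd]
        gcongr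
        have := hz v
        rw [le_div_iff₀ hNd] at this
        linarith
      _ = c * ∑ v, |D v| := by rw [Finset.mul_sum]
      _ ≤ c * B := by gcongr; exact hB ξ hξ
      _ = _ := hcB
  -- If `R` vanished at `y`, the integer `k` would equal minus `b` times a main term of size between
  -- `θ δ` and `θ B` plus an error of at most `θ δ / 2`: nonzero, yet of absolute value below `1`.
  obtain ⟨k, hk⟩ := hint N z hNpos
  have hkS : (k : ℝ) = -(b * (θ * D v₀ + ∑ v, N ^ d * (y v - (x v + e v / N ^ d)) * D v)) := by
    rw [← hk, ← hsplit, ← hmv]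
    ring
  have hDlow : δ ≤ |D v₀| := hδK ξ hξ
  have hDup : |D v₀| ≤ B := hBv ξ hξ v₀
  set S := ∑ v, N ^ d * (y v - (x v + e v / N ^ d)) * D v
  have habs : |(k : ℝ)| = b * |θ * D v₀ + S| := by
    rw [hkS, abs_neg, abs_mul, abs_of_nonneg (by linarith)]
  have hθD : |θ * D v₀| = θ * |D v₀| := by rw [abs_mul, abs_of_pos hθ0]
  have hθδ : 0 < θ * δ := by positivity
  have hlow : 0 < |θ * D v₀ + S| := by
    have h1 := abs_sub_abs_le_abs_sub (θ * D v₀) (-S)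
    rw [sub_neg_eq_add, abs_neg, hθD] at h1
    nlinarith
  have hup : |θ * D v₀ + S| ≤ 2 * (θ * B) := by
    have h1 := abs_add_le (θ * D v₀) S
    rw [hθD] at h1
    nlinarith
  have hk1 : |(k : ℝ)| < 1 := by
    rw [habs]
    nlinarith
  have hk0 : k = 0 := by
    rw [← Int.abs_lt_one_iff]
    exact_mod_cast hk1
  rw [hk0, Int.cast_zero, abs_zero] at habs
  have : 0 < b * |θ * D v₀ + S| := mul_pos (by linarith) hlow
  linarith

end Calculus

end MvPolynomial

/-! ### Growth comparison for choosing `N` -/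

open Filter Topology in
theorem eventually_mul_rpow_le_mul_rpow {a b : ℝ} (hab : a < b) (C : ℝ) {K : ℝ} (hK : 0 < K) :
    ∀ᶠ N : ℕ in atTop, C * (N : ℝ) ^ a ≤ K * (N : ℝ) ^ b := by
  have h : Tendsto (fun N : ℕ => C * (N : ℝ) ^ (-(b - a))) atTop (𝓝 (C * 0)) :=
    ((tendsto_rpow_neg_atTop (sub_pos.mpr hab)).comp tendsto_natCast_atTop_atTop).const_mul C
  rw [mul_zero] at h
  filter_upwards [h.eventually (ge_mem_nhds hK), eventually_gt_atTop 0] with N hN hN0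
  have hN' : (0 : ℝ) < N := by exact_mod_cast hN0
  have : (N : ℝ) ^ a = (N : ℝ) ^ (-(b - a)) * (N : ℝ) ^ b := by
    rw [← Real.rpow_add hN']
    ring_nf
  rw [this, ← mul_assoc]
  gcongr

/-! ### Cantor stages and Lipschitz bounds -/

open Metric

/-- A finite stage in the construction of a Cantor set: a grid of `card ^ n` equal balls
in the unit ball of Euclidean space. -/
structure CantorStage (n : ℕ) where
  radius : ℝ
  card : ℕ
  center : (Fin n → ℕ) → EuclideanSpace ℝ (Fin n)
  radius_pos : 0 < radius
  radius_le_one : radius ≤ 1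
  card_pos : 0 < card
  norm_center_add_le : ∀ A, ‖center A‖ + radius ≤ 1

namespace CantorStage

variable {n : ℕ}

/-- The union of the balls of a stage. -/
def region (S : CantorStage n) : Set (EuclideanSpace ℝ (Fin n)) :=
  ⋃ A, closedBall (S.center A) S.radius

/-- `S'` is obtained from `S` by replacing each ball with `M ^ n` smaller balls inside it, which are
separated with constant `D`. -/
structure Refines (S S' : CantorStage n) (M : ℕ) (D : ℝ) : Prop where
  card_eq : S'.card = S.card * M
  radius_le : S'.radius ≤ S.radius / 2
  dist_center_add_le : ∀ A, dist (S'.center A) (S.center fun l => A l / M) + S'.radius ≤ S.radius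
  separated : ∀ A B : Fin n → ℕ, (∀ l, A l / M = B l / M) →
    ∀ x ∈ closedBall (S'.center A) S'.radius, ∀ y ∈ closedBall (S'.center B) S'.radius,
      ∀ l, |(A l : ℝ) - B l| * S.radius ≤ D * M * dist x y

/-- A property of sets which can be achieved at the next stage of the construction of a Cantor set
of dimension `n / d`. -/
def Achievable (d : ℕ) (G : Set (EuclideanSpace ℝ (Fin n)) → Prop) : Prop :=
  ∃ D ρ : ℝ, 0 < D ∧ 0 < ρ ∧ ∀ S : CantorStage n, S.radius ≤ ρ → ∀ τ τ' D' ρ' : ℝ, 0 < ρ' →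
    d * τ < 1 → 1 < d * τ' → ∃ (S' : CantorStage n) (M : ℕ), S.Refines S' M D ∧
      S'.radius ≤ ρ' ∧ D' * S'.radius ^ (-τ) ≤ S'.card ∧ S'.card ≤ S'.radius ^ (-τ') ∧ G S'.region

end CantorStage

/-- `C¹` maps are Lipschitz on compact sets. The inverse is controlled on the 1-neighbourhood of the
image of the ball, since lattice points to be pulled back need not lie in the image itself. -/
theorem exists_lipschitz_const_unitBall {V : Type*} [NormedAddCommGroup V] [NormedSpace ℝ V]
    [FiniteDimensional ℝ V] (Φ : V ≃ V) (h : ContDiff ℝ 1 Φ) (h' : ContDiff ℝ 1 Φ.symm) :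
    ∃ L : ℝ, (∀ x ∈ closedBall (0 : V) 1, ∀ y ∈ closedBall (0 : V) 1,
        dist (Φ x) (Φ y) ≤ L * dist x y) ∧
      ∀ x ∈ closedBall (0 : V) 1, ∀ w, dist w (Φ x) ≤ 1 →
        dist (Φ.symm w) x ≤ L * dist w (Φ x) := by
  have : ProperSpace V := FiniteDimensional.proper_real V
  obtain ⟨K₁, hK₁⟩ := (h.locallyLipschitz.locallyLipschitzOn
    (s := closedBall 0 1)).exists_lipschitzOnWith_of_compact (isCompact_closedBall 0 1)
  obtain ⟨K₂, hK₂⟩ := (h'.locallyLipschitz.locallyLipschitzOn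
    (s := cthickening 1 (Φ '' closedBall 0 1))).exists_lipschitzOnWith_of_compact
      ((isCompact_closedBall 0 1).image h.continuous).cthickening
  refine ⟨max K₁ K₂, fun x hx y hy => ?_, fun x hx w hw => ?_⟩
  · refine (hK₁.dist_le_mul x hx y hy).trans ?_
    gcongr
    exact le_max_left _ _
  · have h1 : Φ x ∈ Φ '' closedBall 0 1 := ⟨x, hx, rfl⟩
    have := hK₂.dist_le_mul w (mem_cthickening_of_dist_le _ _ _ _ h1 hw) (Φ x)
      (self_subset_cthickening _ h1)
    rw [Φ.symm_apply_apply] at this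
    refine this.trans ?_
    gcongr
    exact le_max_right _ _

theorem EuclideanSpace.norm_le_card_mul {n : ℕ} (x : EuclideanSpace ℝ (Fin n)) {b : ℝ}
    (hx : ∀ l, |x l| ≤ b) : ‖x‖ ≤ n * b := by
  have h1 : ‖x‖ ≤ ∑ l, |x l| := by
    rw [EuclideanSpace.norm_eq]
    refine Real.sqrt_le_iff.mpr ⟨Finset.sum_nonneg fun _ _ => abs_nonneg _, ?_⟩
    exact Finset.sum_sq_le_sq_sum_of_nonneg fun _ _ => abs_nonneg _
  refine h1.trans ((Finset.sum_le_sum fun l _ => hx l).trans ?_)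
  simp

theorem EuclideanSpace.abs_apply_le_norm {n : ℕ} (x : EuclideanSpace ℝ (Fin n)) (l : Fin n) :
    |x l| ≤ ‖x‖ := by
  simpa using PiLp.norm_apply_le x l

/-! ### One stage from a pulled-back lattice -/

namespace CantorStage

variable {n : ℕ}

/-- The points near `q` of a translate of the lattice `(1/N)ℤ^n` by `s`, indexed by `A` modulo `M`. -/
noncomputable def latticePoint (N M : ℕ) (s q : EuclideanSpace ℝ (Fin n)) (A : Fin n → ℕ) :
    EuclideanSpace ℝ (Fin n) :=
  WithLp.toLp 2 fun l => ((⌊N * q l⌋ + (A l % M : ℕ) : ℤ) : ℝ) / N + s l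

theorem dist_latticePoint_le {N M : ℕ} (hN : 0 < N) (hM : 0 < M)
    {s : EuclideanSpace ℝ (Fin n)} (hs : ‖s‖ ≤ 1 / N) (q : EuclideanSpace ℝ (Fin n))
    (A : Fin n → ℕ) : dist (latticePoint N M s q A) q ≤ n * ((M + 2) / N) := by
  rw [dist_eq_norm]
  refine EuclideanSpace.norm_le_card_mul _ fun l => ?_
  have hN' : (0 : ℝ) < N := by exact_mod_cast hN
  have h1 : ((A l % M : ℕ) : ℝ) ≤ M := by exact_mod_cast (Nat.mod_lt _ hM).le
  have h2 := Int.floor_le (N * q l)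
  have h3 := (Int.lt_floor_add_one (N * q l)).le
  have h4 : |s l| ≤ 1 / N := (EuclideanSpace.abs_apply_le_norm s l).trans hs
  have h0 : (0 : ℝ) ≤ (A l % M : ℕ) := Nat.cast_nonneg _
  simp only [latticePoint, PiLp.sub_apply, Int.cast_add, Int.cast_natCast]
  have e : ((⌊N * q l⌋ : ℝ) + (A l % M : ℕ)) / N + s l - q l =
      ((⌊N * q l⌋ - N * q l) + (A l % M : ℕ)) / N + s l := by
    field_simp
    ring
  have h5 : |((⌊N * q l⌋ - N * q l) + (A l % M : ℕ)) / N| ≤ (M + 1) / N := by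
    rw [abs_div, abs_of_pos hN']
    gcongr
    rw [abs_le]
    constructor <;> linarith
  rw [e]
  refine (abs_add_le _ _).trans ((add_le_add h5 h4).trans (le_of_eq ?_))
  ring

/-- For siblings, the floor and the shift cancel, and equal quotients make the difference of
residues the difference of indices. -/
theorem abs_sub_div_le_dist_latticePoint {N M : ℕ} (s q : EuclideanSpace ℝ (Fin n))
    {A B : Fin n → ℕ} {l : Fin n} (h : A l / M = B l / M) :
    |(A l : ℝ) - B l| / N ≤ dist (latticePoint N M s q A) (latticePoint N M s q B) := by
  rw [dist_eq_norm]
  refine le_trans (le_of_eq ?_) (EuclideanSpace.abs_apply_le_norm _ l)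
  have hmod : (A l : ℝ) - B l = (A l % M : ℕ) - (B l % M : ℕ) := by
    have hA : (A l : ℝ) = (M : ℝ) * (A l / M : ℕ) + (A l % M : ℕ) := by
      exact_mod_cast (Nat.div_add_mod (A l) M).symm
    have hB : (B l : ℝ) = (M : ℝ) * (B l / M : ℕ) + (B l % M : ℕ) := by
      exact_mod_cast (Nat.div_add_mod (B l) M).symm
    rw [hA, hB, h]
    ring
  rw [hmod]
  simp only [latticePoint, PiLp.sub_apply, Int.cast_add, Int.cast_natCast]
  rw [← Nat.abs_cast N, ← abs_div, Nat.abs_cast]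
  congr 1
  ring

/-- A property is achievable if it holds for all sets for which, on a separated family of sets
`Q i`, the image under `Φ i` is close enough to a small translate of the lattice `(1/N)ℤ^n`. -/
theorem achievable_of_lattice {I : Type*} [Finite I] [Nonempty I] {d : ℕ} (hd : 1 ≤ d)
    (Φ : I → EuclideanSpace ℝ (Fin n) ≃ EuclideanSpace ℝ (Fin n))
    (hΦ : ∀ i, ContDiff ℝ 1 (Φ i)) (hΦ' : ∀ i, ContDiff ℝ 1 (Φ i).symm)
    (Q : I → Set (EuclideanSpace ℝ (Fin n))) {ρ : ℝ} (hρ : 0 < ρ)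
    (hQ : ∀ i j, i ≠ j → ∀ x ∈ Q i, ∀ y ∈ Q j, 2 * ρ < dist x y)
    (s : I → EuclideanSpace ℝ (Fin n)) (hs : ∀ i, ‖s i‖ ≤ 1) {c : ℝ} (hc : 0 < c) (N₀ : ℕ)
    (G : Set (EuclideanSpace ℝ (Fin n)) → Prop)
    (hG : ∀ F : Set (EuclideanSpace ℝ (Fin n)), ∀ N : ℕ, N₀ ≤ N →
      (∀ i, ∀ x ∈ F, x ∈ Q i → ∃ z : Fin n → ℤ, ∀ l,
        |Φ i x l - ((z l : ℝ) / N + s i l / N ^ d)| ≤ c / N ^ d) → G F) :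
    Achievable d G := by
  classical
  obtain ⟨L, hL1, hL, hL'⟩ : ∃ L : ℝ, 1 ≤ L ∧
      (∀ i, ∀ x ∈ closedBall (0 : EuclideanSpace ℝ (Fin n)) 1,
        ∀ y ∈ closedBall (0 : EuclideanSpace ℝ (Fin n)) 1,
          dist (Φ i x) (Φ i y) ≤ L * dist x y) ∧
      ∀ i, ∀ x ∈ closedBall (0 : EuclideanSpace ℝ (Fin n)) 1, ∀ w, dist w (Φ i x) ≤ 1 →
        dist ((Φ i).symm w) x ≤ L * dist w (Φ i x) := by
    choose L h1 h2 using fun i => exists_lipschitz_const_unitBall (Φ i) (hΦ i) (hΦ' i)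
    obtain ⟨L', hL'⟩ := (Set.finite_range L).bddAbove
    have hle : ∀ i, L i ≤ max 1 L' := fun i => (hL' ⟨i, rfl⟩).trans (le_max_right _ _)
    refine ⟨max 1 L', le_max_left _ _, fun i x hx y hy => (h1 i x hx y hy).trans ?_,
      fun i x hx w hw => (h2 i x hx w hw).trans ?_⟩
    · exact mul_le_mul_of_nonneg_right (hle i) dist_nonneg
    · exact mul_le_mul_of_nonneg_right (hle i) dist_nonneg
  have hL0 : 0 < L := by linarith
  -- About `κ r N` lattice points per axis, for `r` the parent radius, keep the pulled-back centers
  -- within `r / 2` of the parent center. The two terms of `c'` keep the image of a child ball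
  -- within `c / N^d` of its lattice point and the child radius small against the spacing `1/N`.
  set κ : ℝ := 1 / (4 * (n + 1) * L) with hκ
  have hκ0 : 0 < κ := by positivity
  set c' : ℝ := min (c / L) (1 / (4 * L)) with hc'
  have hc'0 : 0 < c' := by positivity
  refine ⟨4 * L / κ, ρ, by positivity, hρ, ?_⟩
  intro S hSρ τ τ' D' ρ' hρ' hτ hτ'
  have hr0 := S.radius_pos
  have hcard : (0 : ℝ) < S.card := by exact_mod_cast S.card_pos
  -- The number of children per axis grows like `N` and the inverse radius like `N^d`, so the last
  -- two bounds reduce to `d τ < 1 < d τ'`.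
  obtain ⟨N, hN₀, hN0, hN1, hN2, hN3, hN4, hN5⟩ : ∃ N : ℕ, N₀ ≤ N ∧ 0 < N ∧
      8 * (n + 1) * L ≤ S.radius * N ∧ 1 ≤ κ * S.radius * N ∧
      c' / N ^ d ≤ min (S.radius / 2) ρ' ∧
      D' * (c' / N ^ d) ^ (-τ) ≤ S.card * (κ * S.radius * N / 2) ∧
      S.card * (κ * S.radius * N) ≤ (c' / N ^ d) ^ (-τ') := by
    have lin : ∀ a b : ℝ, 0 < b → ∀ᶠ N : ℕ in Filter.atTop, a ≤ b * N := fun a b hb => by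
      simpa using eventually_mul_rpow_le_mul_rpow zero_lt_one a hb
    have pow : ∀ (N : ℕ) (t : ℝ), (c' / (N : ℝ) ^ d) ^ (-t) = c' ^ (-t) * (N : ℝ) ^ (d * t) := by
      intro N t
      rw [Real.div_rpow hc'0.le (by positivity), Real.rpow_neg (by positivity : (0:ℝ) ≤ N ^ d),
        div_inv_eq_mul, Real.rpow_mul (by positivity), Real.rpow_natCast]
    have hm : 0 < min (S.radius / 2) ρ' := by positivity
    have h := (Filter.eventually_ge_atTop N₀).and <| (Filter.eventually_gt_atTop 0).and <|
      (lin (8 * (n + 1) * L) _ hr0).and <| (lin 1 (κ * S.radius) (by positivity)).and <|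
      (lin c' _ hm).and <|
      (eventually_mul_rpow_le_mul_rpow hτ (D' * c' ^ (-τ))
        (by positivity : 0 < S.card * (κ * S.radius / 2))).and <|
      (eventually_mul_rpow_le_mul_rpow hτ' (S.card * (κ * S.radius))
        (by positivity : 0 < c' ^ (-τ')))
    obtain ⟨N, h0, h1, h2, h3, h4, h5, h6⟩ := h.exists
    refine ⟨N, h0, h1, h2, h3, ?_, ?_, ?_⟩
    · rw [div_le_iff₀ (by positivity)]
      refine h4.trans ?_
      gcongr
      exact le_self_pow₀ (by exact_mod_cast h1) (by omega)
    · rw [pow, ← mul_assoc]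
      refine h5.trans (le_of_eq ?_)
      rw [Real.rpow_one]
      ring
    · rw [pow]
      refine le_trans (le_of_eq ?_) h6
      rw [Real.rpow_one]
      ring
  have hN' : (0 : ℝ) < N := by exact_mod_cast hN0
  have hN1' : (1 : ℝ) ≤ N := by exact_mod_cast hN0
  have hNd : (N : ℝ) ≤ N ^ d := le_self_pow₀ hN1' (by omega)
  have hNd0 : (0 : ℝ) < N ^ d := by positivity
  set r' : ℝ := c' / N ^ d with hr'
  have hr'0 : 0 < r' := by positivity
  have hr'r : r' ≤ S.radius / 2 := hN3.trans (min_le_left _ _)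
  have hr'c : L * r' ≤ c / N ^ d := by
    rw [hr', mul_div_assoc']
    gcongr
    have := min_le_left (c / L) (1 / (4 * L))
    rw [le_div_iff₀ hL0] at this
    linarith
  have hr'N : 4 * L * r' ≤ 1 / N := by
    have h1 : 4 * L * c' ≤ 1 := by
      have := min_le_right (c / L) (1 / (4 * L))
      rw [le_div_iff₀ (by positivity)] at this
      linarith
    rw [hr', mul_div_assoc']
    exact div_le_div₀ zero_le_one h1 hN' hNd
  set M : ℕ := ⌊κ * S.radius * N⌋₊ with hM
  have hM0 : 0 < M := Nat.floor_pos.mpr hN2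
  have hMle : (M : ℝ) ≤ κ * S.radius * N := Nat.floor_le (by positivity)
  have hMge : κ * S.radius * N / 2 ≤ M := by
    have h1 : κ * S.radius * N < M + 1 := Nat.lt_floor_add_one _
    have h2 : (1 : ℝ) ≤ M := by exact_mod_cast hM0
    linarith
  -- A parent ball has diameter at most `2 ρ`, so it meets at most one `Q i`, which dictates the
  -- diffeomorphism used there; if it meets none, any choice will do.
  set sel : EuclideanSpace ℝ (Fin n) → I := fun p =>
    if h : ∃ i, (closedBall p S.radius ∩ Q i).Nonempty then h.choose else Classical.arbitrary I
  have hsel : ∀ p i x, x ∈ closedBall p S.radius → x ∈ Q i → sel p = i := by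
    intro p i x hx hxi
    have h : ∃ i, (closedBall p S.radius ∩ Q i).Nonempty := ⟨i, x, hx, hxi⟩
    have e : sel p = h.choose := dif_pos h
    obtain ⟨y, hy, hyj⟩ := h.choose_spec
    rw [e]
    by_contra hne
    have h1 := hQ _ _ hne y hyj x hxi
    have h2 := dist_triangle_right y x p
    rw [mem_closedBall] at hx hy
    linarith
  set par : (Fin n → ℕ) → EuclideanSpace ℝ (Fin n) := fun A => S.center fun l => A l / M
  set w : (Fin n → ℕ) → EuclideanSpace ℝ (Fin n) := fun A =>
    latticePoint N M ((1 / (N : ℝ) ^ d) • s (sel (par A))) (Φ (sel (par A)) (par A)) A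
  set p' : (Fin n → ℕ) → EuclideanSpace ℝ (Fin n) := fun A => (Φ (sel (par A))).symm (w A)
  have hΦp' : ∀ A, Φ (sel (par A)) (p' A) = w A := fun A => Equiv.apply_symm_apply _ _
  have hpar : ∀ A, par A ∈ closedBall 0 1 := by
    intro A
    have := S.norm_center_add_le fun l => A l / M
    rw [mem_closedBall_zero_iff]
    simp only [par]
    linarith
  have hshift : ∀ i, ‖(1 / (N : ℝ) ^ d) • s i‖ ≤ 1 / N := by
    intro i
    rw [norm_smul, Real.norm_of_nonneg (by positivity)]
    calc 1 / (N : ℝ) ^ d * ‖s i‖ ≤ 1 / (N : ℝ) ^ d * 1 := by gcongr; exact hs i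
      _ ≤ 1 / N := by rw [mul_one]; gcongr
  have hp'par : ∀ A, dist (p' A) (par A) ≤ S.radius / 2 := by
    intro A
    have h1 : dist (w A) (Φ (sel (par A)) (par A)) ≤ S.radius / (2 * L) := by
      refine (dist_latticePoint_le hN0 hM0 (hshift _) _ _).trans ?_
      rw [mul_div_assoc', div_le_div_iff₀ hN' (by positivity)]
      have h2 : (4 * (n + 1) * L) * M ≤ S.radius * N := by
        calc (4 * (n + 1) * L) * (M : ℝ) ≤ (4 * (n + 1) * L) * (κ * S.radius * N) := by gcongr
          _ = S.radius * N := by rw [hκ]; field_simp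
      have h3 : (0 : ℝ) ≤ L * M := by positivity
      nlinarith
    have h2 : S.radius / (2 * L) ≤ 1 := by
      rw [div_le_one (by positivity)]
      linarith [S.radius_le_one]
    calc dist (p' A) (par A) ≤ L * dist (w A) (Φ (sel (par A)) (par A)) :=
          hL' _ _ (hpar A) _ (h1.trans h2)
      _ ≤ L * (S.radius / (2 * L)) := by gcongr
      _ = S.radius / 2 := by field_simp
  have hnest : ∀ A, dist (p' A) (par A) + r' ≤ S.radius := fun A => by linarith [hp'par A]
  have hnorm : ∀ A, ‖p' A‖ + r' ≤ 1 := by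
    intro A
    have h1 := S.norm_center_add_le fun l => A l / M
    have h2 := dist_triangle (p' A) (par A) 0
    rw [dist_zero_right, dist_zero_right] at h2
    linarith [hnest A]
  have hball : ∀ A, closedBall (p' A) r' ⊆ closedBall 0 1 := fun A =>
    closedBall_subset_closedBall' (by rw [dist_zero_right, add_comm]; exact hnorm A)
  have hp'1 : ∀ A, p' A ∈ closedBall 0 1 := fun A => hball A (mem_closedBall_self hr'0.le)
  refine ⟨⟨r', S.card * M, p', hr'0, by linarith [S.radius_le_one], Nat.mul_pos S.card_pos hM0,
    hnorm⟩, M, ⟨rfl, hr'r, hnest, ?_⟩, hN3.trans (min_le_right _ _), ?_, ?_, ?_⟩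
  · intro A B hAB x hx y hy l
    have hparAB : par A = par B := congrArg S.center (funext hAB)
    have h1 : |(A l : ℝ) - B l| / N ≤ L * dist (p' A) (p' B) := by
      refine le_trans ?_ (hL (sel (par A)) _ (hp'1 A) _ (hp'1 B))
      have : Φ (sel (par A)) (p' B) = w B := by rw [hparAB]; exact hΦp' B
      rw [hΦp', this]
      simp only [w, hparAB]
      exact abs_sub_div_le_dist_latticePoint _ _ (hAB l)
    have h2 : dist (p' A) (p' B) ≤ dist x y + 2 * r' := by
      rw [mem_closedBall] at hx hy
      have h3 := dist_triangle4 (p' A) x y (p' B)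
      rw [dist_comm (p' A) x] at h3
      linarith
    by_cases hl : A l = B l
    · rw [hl, sub_self, abs_zero, zero_mul]
      positivity
    have h3 : (1 : ℝ) ≤ |(A l : ℝ) - B l| := by
      have : (1 : ℤ) ≤ |(A l : ℤ) - B l| := Int.one_le_abs (sub_ne_zero.mpr (by exact_mod_cast hl))
      exact_mod_cast this
    -- Passing from centers to points costs `2 L r' ≤ 1 / (2 N)`, at most half of the left side
    -- because distinct indices differ by at least one.
    have h4 : |(A l : ℝ) - B l| ≤ 2 * L * N * dist x y := by
      have h5 : L * dist (p' A) (p' B) ≤ L * (dist x y + 2 * r') := by gcongr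
      have h6 := h1.trans h5
      have h7 : 1 / (N : ℝ) ≤ |(A l : ℝ) - B l| / N := by gcongr
      have h8 : |(A l : ℝ) - B l| / N ≤ 2 * L * dist x y := by nlinarith
      rw [div_le_iff₀ hN'] at h8
      linarith
    have h5 : S.radius * N ≤ 2 / κ * M := by
      rw [div_mul_eq_mul_div, le_div_iff₀ hκ0]
      linarith
    calc |(A l : ℝ) - B l| * S.radius ≤ 2 * L * N * dist x y * S.radius := by gcongr
      _ = 2 * L * dist x y * (S.radius * N) := by ring
      _ ≤ 2 * L * dist x y * (2 / κ * M) := by gcongr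
      _ = _ := by ring
  · refine hN4.trans ?_
    push_cast
    gcongr
  · refine le_trans ?_ hN5
    push_cast
    gcongr
  · refine hG _ N hN₀ fun i x hxF hxi => ?_
    obtain ⟨A, hA⟩ := Set.mem_iUnion.mp hxF
    simp only at hA
    have hxp : x ∈ closedBall (par A) S.radius :=
      closedBall_subset_closedBall' (by linarith [hnest A, dist_comm (p' A) (par A)]) hA
    have hi := hsel _ _ _ hxp hxi
    refine ⟨fun l => ⌊N * Φ i (par A) l⌋ + (A l % M : ℕ), fun l => ?_⟩
    have h1 : dist (Φ i x) (w A) ≤ c / N ^ d := by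
      rw [← hΦp' A, hi]
      refine (hL i x (hball A hA) _ (hp'1 A)).trans (le_trans ?_ hr'c)
      gcongr
      exact hA
    refine le_trans (le_of_eq ?_) ((EuclideanSpace.abs_apply_le_norm _ l).trans
      ((dist_eq_norm _ _).symm.le.trans h1))
    simp only [w, hi, latticePoint, PiLp.sub_apply, PiLp.smul_apply, smul_eq_mul]
    congr 3
    ring

end CantorStage

/-! ### The limit set and its dimension -/

namespace CantorStage

variable {n : ℕ}

/-- The Cantor set determined by a sequence of stages. -/
def limitSet (S : ℕ → CantorStage n) : Set (EuclideanSpace ℝ (Fin n)) :=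
  ⋂ k, ⋃ A : Fin n → Fin (S k).card, closedBall ((S k).center fun l => A l) (S k).radius

theorem limitSet_subset_region (S : ℕ → CantorStage n) (k : ℕ) : limitSet S ⊆ (S k).region :=
  (Set.iInter_subset _ k).trans <| Set.iUnion_subset fun A =>
    Set.subset_iUnion (fun A => closedBall ((S k).center A) (S k).radius) fun l => (A l : ℕ)

theorem isCompact_limitSet (S : ℕ → CantorStage n) : IsCompact (limitSet S) := by
  have h : ∀ k, IsCompact
      (⋃ A : Fin n → Fin (S k).card, closedBall ((S k).center fun l => A l) (S k).radius) :=
    fun k => isCompact_iUnion fun A => isCompact_closedBall _ _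
  exact (h 0).of_isClosed_subset (isClosed_iInter fun k => (h k).isClosed) (Set.iInter_subset _ 0)

section Dimension

variable {S : ℕ → CantorStage n} {M : ℕ → ℕ} {D : ℕ → ℝ}
  (hS : ∀ k, (S k).Refines (S (k + 1)) (M k) (D k))

include hS

theorem radius_le_pow (k : ℕ) : (S k).radius ≤ (1 / 2) ^ k := by
  induction k with
  | zero => simpa using (S 0).radius_le_one
  | succ k ih =>
    have := (hS k).radius_le
    rw [pow_succ]
    linarith

open Filter Topology in
theorem tendsto_radius : Tendsto (fun k => (S k).radius) atTop (𝓝 0) :=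
  squeeze_zero (fun k => (S k).radius_pos.le) (radius_le_pow hS)
    (tendsto_pow_atTop_nhds_zero_of_lt_one (by norm_num) (by norm_num))

-- At a stage with `card ≤ radius ^ (-t)`, the `card ^ n` balls form a cover whose `n t`-dimensional
-- sum is at most `2 ^ (n t)`.
open Filter in
theorem dimH_limitSet_le {t : NNReal} (ht : ∀ᶠ k in atTop, (S k).card ≤ (S k).radius ^ (-(t : ℝ))) :
    dimH (limitSet S) ≤ (n * t : NNReal) := by
  refine dimH_le_of_hausdorffMeasure_ne_top (ne_top_of_le_ne_top
    (ENNReal.ofReal_ne_top (r := 2 ^ (n * t : ℝ))) ?_)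
  have hr : Tendsto (fun k => ENNReal.ofReal (2 * (S k).radius)) atTop (nhds 0) := by
    have := (tendsto_radius hS).const_mul 2
    rw [mul_zero] at this
    simpa using ENNReal.tendsto_ofReal this
  have hdiam : ∀ k (A : Fin n → Fin (S k).card),
      ediam (closedBall ((S k).center fun l => A l) (S k).radius) ≤
        ENNReal.ofReal (2 * (S k).radius) := by
    intro k A
    rw [← closedEBall_ofReal (S k).radius_pos.le, ENNReal.ofReal_mul zero_le_two]
    simpa using ediam_closedEBall_le
  refine (MeasureTheory.Measure.hausdorffMeasure_le_liminf_sum _ _ _ hr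
    (fun k (A : Fin n → Fin (S k).card) => closedBall ((S k).center fun l => A l) (S k).radius)
    (Eventually.of_forall hdiam) (Eventually.of_forall fun k => Set.iInter_subset _ k)).trans ?_
  refine liminf_le_of_le (by isBoundedDefault) fun b hb => ?_
  obtain ⟨k, hbk, hk⟩ := (hb.and ht).exists
  refine hbk.trans ?_
  have hr0 := (S k).radius_pos
  calc _ ≤ ∑ _A : Fin n → Fin (S k).card,
        ENNReal.ofReal (2 * (S k).radius) ^ ((n * t : NNReal) : ℝ) := by
        refine Finset.sum_le_sum fun A _ => ?_
        exact ENNReal.rpow_le_rpow (hdiam k A) (NNReal.coe_nonneg _)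
    _ = ENNReal.ofReal ((S k).card ^ n * (2 * (S k).radius) ^ (n * t : ℝ)) := by
        rw [Finset.sum_const, ENNReal.ofReal_rpow_of_pos (by positivity), nsmul_eq_mul,
          ENNReal.ofReal_mul (by positivity)]
        simp
    _ ≤ _ := by
        refine ENNReal.ofReal_le_ofReal ?_
        calc ((S k).card : ℝ) ^ n * (2 * (S k).radius) ^ (n * t : ℝ)
            ≤ ((S k).radius ^ (-(t : ℝ))) ^ n * (2 * (S k).radius) ^ (n * t : ℝ) := by gcongr
          _ = 2 ^ (n * t : ℝ) := by
            rw [← Real.rpow_natCast, ← Real.rpow_mul hr0.le, Real.mul_rpow zero_le_two hr0.le,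
              mul_left_comm, ← Real.rpow_add hr0]
            ring_nf
            simp

/-- Makes `⌊card * t⌋₊` a consistent address: a real number `t` selects a nested sequence of balls.
-/
theorem floor_card_mul_div (k : ℕ) (t : ℝ) :
    ⌊(S (k + 1)).card * t⌋₊ / M k = ⌊(S k).card * t⌋₊ := by
  rw [← Nat.floor_div_natCast, (hS k).card_eq]
  have hM : (M k : ℝ) ≠ 0 := by
    have := (S (k + 1)).card_pos
    rw [(hS k).card_eq] at this
    exact_mod_cast (Nat.pos_of_mul_pos_left this).ne'
  congr 1
  push_cast
  field_simp

/-- The points of the Cantor set with prescribed mixed radix digits. -/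
theorem exists_mem_closedBall_floor (t : Fin n → ℝ) :
    ∃ x, ∀ k, x ∈ closedBall ((S k).center fun l => ⌊(S k).card * t l⌋₊) (S k).radius := by
  have := IsCompact.nonempty_iInter_of_sequence_nonempty_isCompact_isClosed
    (fun k => closedBall ((S k).center fun l => ⌊(S k).card * t l⌋₊) (S k).radius)
    (fun k => closedBall_subset_closedBall' ?_)
    (fun k => nonempty_closedBall.mpr (S k).radius_pos.le) (isCompact_closedBall _ _)
    (fun k => isClosed_closedBall)
  · obtain ⟨x, hx⟩ := this
    exact ⟨x, Set.mem_iInter.mp hx⟩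
  · have := (hS k).dist_center_add_le fun l => ⌊(S (k + 1)).card * t l⌋₊
    simp only [floor_card_mul_div hS] at this
    rw [add_comm]
    exact this

/-- At the last common stage `K`, separation of siblings gives `|t l - u l| * card * radius ≤ 2 * D
K * dist x y`. The bound on `card` and `dist x y ≤ 2 * radius` turn this into a Hölder estimate
whose constant no longer depends on `D K`. -/
theorem abs_sub_le_dist_rpow (hD : ∀ k, 0 < D k) (hcard : ∀ k, k ≤ (S k).card) {τ : ℝ}
    (hτ0 : 0 < τ) (hτ1 : τ ≤ 1) {k₀ : ℕ}
    (hτ : ∀ k, k₀ ≤ k → D k * (S k).radius ^ (-τ) ≤ (S k).card) {t u : Fin n → ℝ}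
    (ht : ∀ l, 0 ≤ t l) (hu : ∀ l, 0 ≤ u l)
    (htu : ∀ l, ⌊(S k₀).card * t l⌋₊ = ⌊(S k₀).card * u l⌋₊) {x y : EuclideanSpace ℝ (Fin n)}
    (hx : ∀ k, x ∈ closedBall ((S k).center fun l => ⌊(S k).card * t l⌋₊) (S k).radius)
    (hy : ∀ k, y ∈ closedBall ((S k).center fun l => ⌊(S k).card * u l⌋₊) (S k).radius)
    (l : Fin n) : |t l - u l| ≤ 4 * dist x y ^ τ := by
  classical
  have hfloor : ∀ k, |t l - u l| * (S k).card ≤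
      |(⌊(S k).card * t l⌋₊ : ℝ) - ⌊(S k).card * u l⌋₊| + 1 := by
    intro k
    have h1 := Nat.floor_le (mul_nonneg (Nat.cast_nonneg (α := ℝ) (S k).card) (ht l))
    have h2 := Nat.lt_floor_add_one ((S k).card * t l)
    have h3 := Nat.floor_le (mul_nonneg (Nat.cast_nonneg (α := ℝ) (S k).card) (hu l))
    have h4 := Nat.lt_floor_add_one ((S k).card * u l)
    have h5 : |t l - u l| * (S k).card = |(S k).card * t l - (S k).card * u l| := by
      rw [← mul_sub, abs_mul, Nat.abs_cast, mul_comm]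
    have h6 := le_abs_self ((⌊(S k).card * t l⌋₊ : ℝ) - ⌊(S k).card * u l⌋₊)
    have h7 := neg_abs_le ((⌊(S k).card * t l⌋₊ : ℝ) - ⌊(S k).card * u l⌋₊)
    rw [h5, abs_le]
    constructor <;> linarith
  by_cases hall : ∀ j, ∀ l, ⌊(S (k₀ + j)).card * t l⌋₊ = ⌊(S (k₀ + j)).card * u l⌋₊
  · have : |t l - u l| ≤ 0 := by
      by_contra! hpos
      obtain ⟨N, hN⟩ := exists_nat_gt (1 / |t l - u l|)
      rw [div_lt_iff₀ hpos] at hN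
      have h1 := hfloor (k₀ + N)
      rw [hall N l, sub_self, abs_zero, zero_add] at h1
      have h2 : (N : ℝ) ≤ (S (k₀ + N)).card := by
        exact_mod_cast (Nat.le_add_left N k₀).trans (hcard (k₀ + N))
      nlinarith
    exact this.trans (by positivity)
  · push Not at hall
    obtain ⟨l₁, hl₁⟩ := Nat.find_spec hall
    have hmin := fun j => Nat.find_min (m := j) hall
    generalize Nat.find hall = j at hl₁ hmin
    rcases j with _ | j
    · exact absurd (htu l₁) hl₁
    have hsame := hmin j (Nat.lt_succ_self j)
    push Not at hsame
    rw [← add_assoc] at hl₁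
    have hKk : k₀ ≤ k₀ + j := Nat.le_add_right _ _
    generalize k₀ + j = K at hl₁ hsame hKk
    have hsep := (hS K).separated _ _
      (fun l => by rw [floor_card_mul_div hS, floor_card_mul_div hS]; exact hsame l)
      x (hx (K + 1)) y (hy (K + 1))
    have h1 : (1 : ℝ) ≤ |(⌊(S (K + 1)).card * t l₁⌋₊ : ℝ) - ⌊(S (K + 1)).card * u l₁⌋₊| := by
      have : (1 : ℤ) ≤ |(⌊(S (K + 1)).card * t l₁⌋₊ : ℤ) - ⌊(S (K + 1)).card * u l₁⌋₊| :=
        Int.one_le_abs (sub_ne_zero.mpr (by exact_mod_cast hl₁))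
      exact_mod_cast this
    have hr0 := (S K).radius_pos
    have hMpos : (0 : ℝ) < M K := by
      have := (S (K + 1)).card_pos
      rw [(hS K).card_eq] at this
      exact_mod_cast Nat.pos_of_mul_pos_left this
    have h2 : (S K).radius ≤ D K * M K * dist x y :=
      le_trans (by nlinarith) (hsep l₁)
    have h3 : |t l - u l| * (S K).card * (S K).radius ≤ 2 * D K * dist x y := by
      have h4 := mul_le_mul_of_nonneg_right (hfloor (K + 1)) hr0.le
      have h5 := hsep l
      rw [(hS K).card_eq] at h4 h5
      push_cast at h4 h5
      refine le_of_mul_le_mul_left ?_ hMpos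
      linarith
    have hdist : dist x y ≤ 2 * (S K).radius := by
      have e : (fun l => ⌊(S K).card * t l⌋₊) = fun l => ⌊(S K).card * u l⌋₊ := funext hsame
      have hxK := hx K
      have hyK := hy K
      rw [mem_closedBall] at hxK hyK
      rw [e] at hxK
      linarith [dist_triangle_right x y ((S K).center fun l => ⌊(S K).card * u l⌋₊)]
    have hxy : dist x y ≤ dist x y ^ τ * (2 * (S K).radius ^ (1 - τ)) := by
      rcases (dist_nonneg (x := x) (y := y)).eq_or_lt with h0 | h0
      · simp [← h0, Real.zero_rpow hτ0.ne']
      calc dist x y = dist x y ^ τ * dist x y ^ (1 - τ) := by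
            rw [← Real.rpow_add h0]; simp
        _ ≤ dist x y ^ τ * (2 * (S K).radius) ^ (1 - τ) := by
            gcongr
        _ = dist x y ^ τ * (2 ^ (1 - τ) * (S K).radius ^ (1 - τ)) := by
            rw [Real.mul_rpow zero_le_two hr0.le]
        _ ≤ _ := by
            gcongr
            calc (2 : ℝ) ^ (1 - τ) ≤ 2 ^ (1 : ℝ) :=
                  Real.rpow_le_rpow_of_exponent_le one_le_two (by linarith)
              _ = 2 := Real.rpow_one 2
    have hrr : (S K).radius ^ (-τ) * (S K).radius = (S K).radius ^ (1 - τ) := by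
      rw [sub_eq_neg_add, Real.rpow_add hr0, Real.rpow_one]
    have h6 : |t l - u l| * (D K * (S K).radius ^ (1 - τ)) ≤ 2 * D K * dist x y := by
      refine le_trans ?_ h3
      rw [← hrr, ← mul_assoc (D K), ← mul_assoc]
      gcongr
      exact hτ K hKk
    have hpow : 0 < D K * (S K).radius ^ (1 - τ) :=
      mul_pos (hD K) (Real.rpow_pos_of_pos hr0 _)
    refine le_of_mul_le_mul_right ?_ hpow
    calc _ ≤ 2 * D K * dist x y := h6
      _ ≤ 2 * D K * (dist x y ^ τ * (2 * (S K).radius ^ (1 - τ))) := by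
        have := hD K
        gcongr
      _ = _ := by ring

-- Decoding points back to their parameters is `τ`-Hölder from a subset of the limit set onto a cube
-- of dimension `n`. The cube is small enough that all its points share the address `0` at stage
-- `k₀`.
open Filter in
theorem le_dimH_limitSet (hD : ∀ k, 0 < D k) (hcard : ∀ k, k ≤ (S k).card) {τ : NNReal}
    (hτ0 : 0 < τ) (hτ1 : τ ≤ 1)
    (hτ : ∀ᶠ k in atTop, D k * (S k).radius ^ (-(τ : ℝ)) ≤ (S k).card) :
    (n : ℝ≥0∞) * τ ≤ dimH (limitSet S) := by
  obtain ⟨k₀, hk₀⟩ := eventually_atTop.mp hτ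
  have hc₀ : (0 : ℝ) < (S k₀).card := by exact_mod_cast (S k₀).card_pos
  have hc₁ : (1 : ℝ) ≤ (S k₀).card := by exact_mod_cast (S k₀).card_pos
  set T : Set (Fin n → ℝ) := Set.univ.pi fun _ => Set.Ico 0 (1 / (S k₀).card : ℝ) with hT
  have hT0 : ∀ t ∈ T, ∀ l, 0 ≤ t l := fun t ht l => (ht l trivial).1
  have hTfloor : ∀ t ∈ T, ∀ l, ⌊(S k₀).card * t l⌋₊ = 0 := by
    intro t ht l
    have := (ht l trivial).2
    rw [lt_div_iff₀ hc₀] at this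
    rw [Nat.floor_eq_zero]
    linarith
  choose H hH using exists_mem_closedBall_floor hS
  have hHE : H '' T ⊆ limitSet S := by
    rintro _ ⟨t, ht, rfl⟩
    refine Set.mem_iInter.mpr fun k => Set.mem_iUnion.mpr ?_
    have hlt : ∀ l, ⌊(S k).card * t l⌋₊ < (S k).card := by
      intro l
      have hk : (0 : ℝ) < (S k).card := by exact_mod_cast (S k).card_pos
      rw [Nat.floor_lt (mul_nonneg hk.le (hT0 t ht l))]
      have h1 := (ht l trivial).2
      have h2 : 1 / ((S k₀).card : ℝ) ≤ 1 := by
        rw [div_le_one hc₀]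
        exact hc₁
      nlinarith
    exact ⟨fun l => ⟨_, hlt l⟩, hH t k⟩
  have key : ∀ t ∈ T, ∀ u ∈ T, dist t u ≤ 4 * dist (H t) (H u) ^ (τ : ℝ) := by
    intro t ht u hu
    refine (dist_pi_le_iff (by positivity)).mpr fun l => ?_
    exact abs_sub_le_dist_rpow hS hD hcard hτ0 hτ1 hk₀ (hT0 t ht) (hT0 u hu)
      (fun l => by rw [hTfloor t ht, hTfloor u hu]) (hH t) (hH u) l
  have hinj : Set.InjOn H T := by
    intro t ht u hu htu
    have := key t ht u hu
    rw [htu, dist_self, Real.zero_rpow (by exact_mod_cast hτ0.ne'), mul_zero] at this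
    exact dist_le_zero.mp this
  have hleft := hinj.leftInvOn_invFunOn
  have hholder : HolderOnWith 4 τ (Function.invFunOn H T) (H '' T) := by
    rintro _ ⟨t, ht, rfl⟩ _ ⟨u, hu, rfl⟩
    rw [hleft ht, hleft hu, edist_dist, edist_dist, ENNReal.ofReal_rpow_of_nonneg dist_nonneg
      τ.coe_nonneg]
    refine (ENNReal.ofReal_le_ofReal (key t ht u hu)).trans ?_
    rw [ENNReal.ofReal_mul (by norm_num)]
    simp
  have hdim := hholder.dimH_image_le hτ0
  rw [hleft.image_image] at hdim
  have hTdim : dimH T = n := by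
    rw [Real.dimH_of_nonempty_interior]
    · simp
    · rw [hT, interior_pi_set Set.finite_univ]
      refine Set.univ_pi_nonempty_iff.mpr fun _ => ?_
      rw [interior_Ico]
      exact Set.nonempty_Ioo.mpr (by positivity)
  rw [hTdim] at hdim
  calc (n : ℝ≥0∞) * τ ≤ dimH (H '' T) / τ * τ := by gcongr
    _ = dimH (H '' T) := ENNReal.div_mul_cancel (by exact_mod_cast hτ0.ne') ENNReal.coe_ne_top
    _ ≤ _ := dimH_mono hHE

end Dimension

/-! ### Combining countably many properties -/

open Filter Topology in
/-- Countably many properties that are inherited by subsets, and are achievable at each stage of the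
construction of a Cantor set, hold simultaneously for a compact set of dimension `n / d`. -/
theorem exists_compact_of_achievable {d : ℕ} (hd : 1 ≤ d)
    (G : ℕ → Set (EuclideanSpace ℝ (Fin n)) → Prop) (hanti : ∀ k E F, E ⊆ F → G k F → G k E)
    (hG : ∀ k, Achievable d (G k)) :
    ∃ E : Set (EuclideanSpace ℝ (Fin n)), IsCompact E ∧ dimH E = (n : ℝ≥0∞) / (d : ℝ≥0∞) ∧
      ∀ k, G k E := by
  have hd0 : (0 : ℝ) < d := by exact_mod_cast hd
  choose D ρ hD hρ step using hG
  set τ : ℕ → ℝ := fun k => (1 - 1 / ((k : ℝ) + 1)) / d with hτ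
  set τ' : ℕ → ℝ := fun k => (1 + 1 / ((k : ℝ) + 1)) / d with hτ'
  have hfrac : ∀ k : ℕ, 0 < 1 / ((k : ℝ) + 1) := fun k => by positivity
  have hfrac1 : ∀ k : ℕ, 1 / ((k : ℝ) + 1) ≤ 1 := fun k => by
    rw [div_le_one (by positivity)]
    linarith [Nat.cast_nonneg (α := ℝ) k]
  have hτ1 : ∀ k, d * τ k < 1 := fun k => by
    rw [hτ, mul_div_cancel₀ _ hd0.ne']
    linarith [hfrac k]
  have hτ'1 : ∀ k, 1 < d * τ' k := fun k => by
    rw [hτ', mul_div_cancel₀ _ hd0.ne']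
    linarith [hfrac k]
  have hτ0 : ∀ k, 0 ≤ τ k := fun k => div_nonneg (by linarith [hfrac1 k]) hd0.le
  -- Stage `k + 1` must already beat the separation constant `D (k + 1)` of the following step,
  -- which is possible because that constant does not depend on the stage. The extra `k + 1` forces
  -- `card` to infinity.
  choose next M href hnextρ hlow hup hGnext using fun k S hS =>
    step k S hS (τ k) (τ' k) (D (k + 1) + (k + 1)) (ρ (k + 1)) (hρ _) (hτ1 k) (hτ'1 k)
  let start : CantorStage n :=
    ⟨min 1 (ρ 0), 1, fun _ => 0, lt_min one_pos (hρ 0), min_le_left _ _, one_pos, fun _ => by simp⟩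
  let seq : ∀ k, {S : CantorStage n // S.radius ≤ ρ k} := fun k =>
    Nat.rec ⟨start, min_le_right _ _⟩ (fun k s => ⟨next k s.1 s.2, hnextρ k s.1 s.2⟩) k
  set S : ℕ → CantorStage n := fun k => (seq k).1 with hSdef
  have hS : ∀ k, (S k).Refines (S (k + 1)) (M k (S k) (seq k).2) (D k) := fun k => href k _ _
  have hr0 : ∀ k, 0 < (S k).radius := fun k => (S k).radius_pos
  have hlow' : ∀ k, (D (k + 1) + (k + 1)) * (S (k + 1)).radius ^ (-τ k) ≤ (S (k + 1)).card :=
    fun k => hlow k _ _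
  have hup' : ∀ k, (S (k + 1)).card ≤ (S (k + 1)).radius ^ (-τ' k) := fun k => hup k _ _
  have hpow1 : ∀ k, 1 ≤ (S (k + 1)).radius ^ (-τ k) := fun k =>
    Real.one_le_rpow_of_pos_of_le_one_of_nonpos (hr0 _) (S _).radius_le_one
      (by linarith [hτ0 k])
  have hcard : ∀ k, k ≤ (S k).card := by
    intro k
    rcases k with _ | k
    · exact Nat.zero_le _
    · have h1 := hlow' k
      have h2 := hpow1 k
      have h3 := hD (k + 1)
      have h4 : ((k + 1 : ℕ) : ℝ) ≤ (S (k + 1)).card := by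
        push_cast
        have : (0 : ℝ) ≤ k := Nat.cast_nonneg k
        nlinarith
      exact_mod_cast h4
  have hlim : Tendsto (fun k : ℕ => 1 / ((k : ℝ) + 1)) atTop (𝓝 0) :=
    tendsto_one_div_add_atTop_nhds_zero_nat
  have hτlim : Tendsto τ atTop (𝓝 (1 / d)) := by
    simpa [hτ] using (hlim.const_sub 1).div_const (d : ℝ)
  have hτ'lim : Tendsto τ' atTop (𝓝 (1 / d)) := by
    simpa [hτ'] using (hlim.const_add 1).div_const (d : ℝ)
  have hcont : ∀ a : NNReal,
      Tendsto (fun t : NNReal => (n : ℝ≥0∞) * t) (𝓝 a) (𝓝 (n * (a : ℝ≥0∞))) := fun a =>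
    ENNReal.Tendsto.const_mul (ENNReal.continuous_coe.tendsto a)
      (Or.inr (ENNReal.natCast_ne_top n))
  have hquot : (n : ℝ≥0∞) / d = n * (((d : NNReal)⁻¹ : NNReal) : ℝ≥0∞) := by
    rw [ENNReal.coe_inv (by exact_mod_cast (Nat.pos_of_ne_zero (by omega)).ne'), div_eq_mul_inv, ENNReal.coe_natCast]
  rw [hquot]
  refine ⟨limitSet S, isCompact_limitSet S, le_antisymm ?_ ?_, fun k =>
    hanti k _ _ (limitSet_subset_region S (k + 1)) (hGnext k _ _)⟩
  · have hle : ∀ t : NNReal, (d : NNReal)⁻¹ < t → dimH (limitSet S) ≤ n * (t : ℝ≥0∞) := by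
      intro t ht
      have ht' : 1 / (d : ℝ) < t := by
        rw [one_div]
        exact_mod_cast ht
      have := dimH_limitSet_le hS (t := t) ?_
      · simpa using this
      obtain ⟨K, hK⟩ := eventually_atTop.mp (hτ'lim.eventually (gt_mem_nhds ht'))
      refine eventually_atTop.mpr ⟨K + 1, fun k hk => ?_⟩
      obtain ⟨k, rfl⟩ : ∃ j, k = j + 1 := ⟨k - 1, by omega⟩
      refine (hup' k).trans (Real.rpow_le_rpow_of_exponent_ge (hr0 _) (S _).radius_le_one ?_)
      linarith [hK k (by omega)]
    refine ge_of_tendsto ((hcont (d : NNReal)⁻¹).mono_left nhdsWithin_le_nhds :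
      Tendsto _ (𝓝[>] (d : NNReal)⁻¹) _) ?_
    filter_upwards [self_mem_nhdsWithin] with t ht using hle t ht
  · have hge : ∀ t : NNReal, 0 < t → t < (d : NNReal)⁻¹ →
        n * (t : ℝ≥0∞) ≤ dimH (limitSet S) := by
      intro t ht0 ht
      have ht' : t < 1 / (d : ℝ) := by
        rw [one_div]
        exact_mod_cast ht
      have ht1 : t ≤ 1 := by
        refine ht.le.trans (inv_le_one_of_one_le₀ ?_)
        exact_mod_cast hd
      refine le_dimH_limitSet hS hD hcard ht0 ht1 ?_
      obtain ⟨K, hK⟩ := eventually_atTop.mp (hτlim.eventually (lt_mem_nhds ht'))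
      refine eventually_atTop.mpr ⟨K + 1, fun k hk => ?_⟩
      obtain ⟨k, rfl⟩ : ∃ j, k = j + 1 := ⟨k - 1, by omega⟩
      refine le_trans ?_ (hlow' k)
      have hpos := Real.rpow_pos_of_pos (hr0 (k + 1)) (-(t : ℝ))
      have hk0 : (0 : ℝ) ≤ k := Nat.cast_nonneg k
      refine mul_le_mul (by linarith) (Real.rpow_le_rpow_of_exponent_ge (hr0 _)
        (S _).radius_le_one ?_) hpos.le (by linarith [hD (k + 1)])
      linarith [hK k (by omega)]
    have hpos : 0 < (d : NNReal)⁻¹ := inv_pos.mpr (by exact_mod_cast hd)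
    have : (𝓝[<] (d : NNReal)⁻¹).NeBot := nhdsLT_neBot_of_exists_lt ⟨0, hpos⟩
    refine le_of_tendsto ((hcont (d : NNReal)⁻¹).mono_left nhdsWithin_le_nhds :
      Tendsto _ (𝓝[<] (d : NNReal)⁻¹) _) ?_
    filter_upwards [self_mem_nhdsWithin, nhdsWithin_le_nhds (lt_mem_nhds hpos)] with t ht ht0
    exact hge t ht0 ht

end CantorStage

/-! ### Polynomial configurations -/

namespace CantorStage

variable {n : ℕ}

/-- Serves for the data in the enumeration that fail the separation, degree or derivative
conditions. -/
theorem achievable_true {d : ℕ} (hd : 1 ≤ d) :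
    Achievable d fun _ : Set (EuclideanSpace ℝ (Fin n)) => True :=
  achievable_of_lattice hd (fun _ : Unit => Equiv.refl _) (fun _ => contDiff_id)
    (fun _ => contDiff_id) (fun _ => ∅) one_pos (by simp) (fun _ => 0) (by simp) one_pos 0 _
    fun _ _ _ _ => trivial

/-- Avoiding the zeros of `R (Φ₁ x₁, …, Φₘ xₘ)` in a product of separated balls on which some partial
derivative of `R` does not vanish. -/
theorem achievable_aeval_ne_zero {d m : ℕ} (hd : 1 ≤ d)
    (Φ : Fin m → Diffeomorph 𝓘(ℝ, EuclideanSpace ℝ (Fin n)) 𝓘(ℝ, EuclideanSpace ℝ (Fin n))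
      (EuclideanSpace ℝ (Fin n)) (EuclideanSpace ℝ (Fin n)) 1)
    (R : MvPolynomial (Fin m × Fin n) ℚ) (hR : R.totalDegree ≤ d) (v : Fin m × Fin n)
    (a : Fin m → EuclideanSpace ℝ (Fin n)) {ρ : ℝ} (hρ : 0 < ρ)
    (hsep : ∀ i i', i ≠ i' → 4 * ρ < dist (a i) (a i'))
    (hne : ∀ x : Fin m → EuclideanSpace ℝ (Fin n), (∀ i, x i ∈ closedBall (a i) ρ) →
      MvPolynomial.aeval (fun p : Fin m × Fin n => (Φ p.1 (x p.1)) p.2)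
        (MvPolynomial.pderiv v R) ≠ (0 : ℝ)) :
    Achievable d fun F => ∀ x : Fin m → EuclideanSpace ℝ (Fin n),
      (∀ i, x i ∈ F) → (∀ i, x i ∈ closedBall (a i) ρ) →
        MvPolynomial.aeval (fun p : Fin m × Fin n => (Φ p.1 (x p.1)) p.2) R ≠ (0 : ℝ) := by
  have hcont : Continuous fun (x : Fin m → EuclideanSpace ℝ (Fin n)) (p : Fin m × Fin n) =>
      (Φ p.1 (x p.1)) p.2 := by
    refine continuous_pi fun p => ?_
    have h1 : Continuous fun x : Fin m → EuclideanSpace ℝ (Fin n) => Φ p.1 (x p.1) :=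
      (Φ p.1).continuous.comp (continuous_apply p.1)
    exact (PiLp.continuous_apply 2 _ p.2).comp h1
  have hK := (isCompact_univ_pi fun i => isCompact_closedBall (a i) ρ).image hcont
  obtain ⟨θ, c, hθ0, hθ1, hc, N₀, h⟩ := R.exists_shift_aeval_ne_zero hd hR v hK (by
    rintro _ ⟨x, hx, rfl⟩
    exact hne x fun i => hx i trivial)
  have : Nonempty (Fin m) := ⟨v.1⟩
  refine achievable_of_lattice hd (fun i => (Φ i).toEquiv) (fun i => (Φ i).contDiff)
    (fun i => (Φ i).symm.contDiff) (fun i => closedBall (a i) ρ) hρ ?_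
    (fun i => if i = v.1 then EuclideanSpace.single v.2 θ else 0) ?_ hc N₀ _ ?_
  · intro i j hij x hx y hy
    have h1 := hsep i j hij
    have h2 := dist_triangle4 (a i) x y (a j)
    rw [mem_closedBall] at hx hy
    rw [dist_comm (a i) x] at h2
    linarith
  · intro i
    split_ifs
    · simpa [abs_of_pos hθ0] using hθ1
    · simp
  · intro F N hN hF x hxF hxa
    choose z hz using fun i => hF i (x i) (hxF i) (hxa i)
    refine h N hN _ ⟨x, fun i _ => hxa i, rfl⟩ (fun p => z p.1 p.2) fun p => ?_
    have hshift : (if p = v then θ else 0) =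
        (if p.1 = v.1 then EuclideanSpace.single v.2 θ else 0 : EuclideanSpace ℝ (Fin n)) p.2 := by
      by_cases h1 : p.1 = v.1 <;> by_cases h2 : p.2 = v.2 <;> simp [Prod.ext_iff, h1, h2]
    rw [hshift]
    exact hz p.1 p.2

end CantorStage

theorem theorem6p1 {J : Type*} [Countable J] (n : ℕ) (hn : 1 ≤ n)
    (m : J → ℕ) (hm : ∀ j, 0 < m j)
    (P : (j : J) → MvPolynomial (Fin (m j) × Fin n) ℚ) (hP : ∀ j, P j ≠ 0)
    (Φ : (j : J) → Fin (m j) →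
      Diffeomorph 𝓘(ℝ, EuclideanSpace ℝ (Fin n)) 𝓘(ℝ, EuclideanSpace ℝ (Fin n))
        (EuclideanSpace ℝ (Fin n)) (EuclideanSpace ℝ (Fin n)) 1)
    (d : ℕ) (hd : 1 ≤ d)
    (hmax : IsGreatest (Set.range fun j => (P j).totalDegree) d) :
    ∃ E : Set (EuclideanSpace ℝ (Fin n)),
      IsCompact E ∧ dimH E = (n : ℝ≥0∞) / (d : ℝ≥0∞) ∧
      ∀ (j : J) (x : Fin (m j) → EuclideanSpace ℝ (Fin n)),
        (∀ i, x i ∈ E) → Function.Injective x →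
          MvPolynomial.aeval (fun p : Fin (m j) × Fin n => (Φ j p.1 (x p.1)) p.2) (P j)
            ≠ (0 : ℝ) := by
  classical
  let val : (j : J) → MvPolynomial (Fin (m j) × Fin n) ℚ →
      (Fin (m j) → EuclideanSpace ℝ (Fin n)) → ℝ := fun j R x =>
    MvPolynomial.aeval (fun p : Fin (m j) × Fin n => (Φ j p.1 (x p.1)) p.2) R
  have hval : ∀ j R, Continuous (val j R) := by
    intro j R
    refine R.continuous_aeval_real.comp (continuous_pi fun p => ?_)
    have h1 : Continuous fun x : Fin (m j) → EuclideanSpace ℝ (Fin n) => Φ j p.1 (x p.1) :=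
      (Φ j p.1).continuous.comp (continuous_apply p.1)
    exact (PiLp.continuous_apply 2 _ p.2).comp h1
  let q : ℕ → EuclideanSpace ℝ (Fin n) := TopologicalSpace.denseSeq _
  have hq : DenseRange q := TopologicalSpace.denseRange_denseSeq _
  let T := Σ j : J, MvPolynomial (Fin (m j) × Fin n) ℚ × (Fin (m j) × Fin n) ×
    (Fin (m j) → ℕ) × ℕ
  have : ∀ j, Countable (MvPolynomial (Fin (m j) × Fin n) ℚ) := fun j =>
    AddMonoidAlgebra.coeff_injective.countable
  have hcount : Countable T := inferInstance
  obtain ⟨j₀, -⟩ := hmax.1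
  have hne : Nonempty T := ⟨⟨j₀, 0, (⟨0, hm j₀⟩, ⟨0, hn⟩), fun _ => 0, 0⟩⟩
  obtain ⟨f, hf⟩ := exists_surjective_nat T
  let cond : T → Prop := fun t => t.2.1.totalDegree ≤ d ∧
    (∀ i i', i ≠ i' → 4 * (1 / ((t.2.2.2.2 : ℝ) + 1)) < dist (q (t.2.2.2.1 i)) (q (t.2.2.2.1 i'))) ∧
    ∀ x, (∀ i, x i ∈ closedBall (q (t.2.2.2.1 i)) (1 / ((t.2.2.2.2 : ℝ) + 1))) →
      val t.1 (MvPolynomial.pderiv t.2.2.1 t.2.1) x ≠ 0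
  let G : T → Set (EuclideanSpace ℝ (Fin n)) → Prop := fun t F => cond t →
    ∀ x : Fin (m t.1) → EuclideanSpace ℝ (Fin n), (∀ i, x i ∈ F) →
      (∀ i, x i ∈ closedBall (q (t.2.2.2.1 i)) (1 / ((t.2.2.2.2 : ℝ) + 1))) →
        val t.1 t.2.1 x ≠ 0
  have hG : ∀ t, CantorStage.Achievable d (G t) := by
    intro t
    by_cases ht : cond t
    · have := CantorStage.achievable_aeval_ne_zero hd (Φ t.1) t.2.1 ht.1 t.2.2.1
        (fun i => q (t.2.2.2.1 i)) (by positivity) ht.2.1 ht.2.2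
      simpa only [G, ht, forall_const] using this
    · have : G t = fun _ => True := by
        funext F
        simp only [G, ht, false_imp_iff]
      rw [this]
      exact CantorStage.achievable_true hd
  obtain ⟨E, hE, hdim, hGE⟩ := CantorStage.exists_compact_of_achievable hd (fun k => G (f k))
    (fun k A B hAB h hc x hx => h hc x fun i => hAB (hx i)) (fun k => hG (f k))
  refine ⟨E, hE, hdim, fun j x hx hinj h0 => ?_⟩
  obtain ⟨R, v, hRd, hR0, hRv⟩ := MvPolynomial.exists_aeval_pderiv_ne_zero _ d (P j)
    (hmax.2 ⟨j, rfl⟩) (hP j) h0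
  obtain ⟨ε, hε, hball⟩ := Metric.isOpen_iff.mp
    (isOpen_ne_fun (hval j (MvPolynomial.pderiv v R)) continuous_const) x hRv
  obtain ⟨η, hη, hηx⟩ : ∃ η > 0, ∀ i i', i ≠ i' → η ≤ dist (x i) (x i') := by
    have : Nonempty (Fin (m j)) := ⟨⟨0, hm j⟩⟩
    -- The value `1` on the diagonal keeps the minimum positive, also when `m j = 1`.
    obtain ⟨p, hp⟩ := Finite.exists_min fun p : Fin (m j) × Fin (m j) =>
      if p.1 = p.2 then 1 else dist (x p.1) (x p.2)
    refine ⟨_, ?_, fun i i' hii' => (hp (i, i')).trans_eq (if_neg hii')⟩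
    split_ifs with h
    · exact one_pos
    · exact dist_pos.mpr (hinj.ne h)
  -- With centers within `ρ` of the points, `6 ρ < η` leaves them more than `4 ρ` apart, and `2 ρ <
  -- ε` keeps the product of balls where the derivative is nonzero.
  obtain ⟨k, hk⟩ := exists_nat_one_div_lt (show 0 < min (ε / 2) (η / 6) by positivity)
  set ρ : ℝ := 1 / ((k : ℝ) + 1) with hρ
  have hρ0 : 0 < ρ := by positivity
  have hρε : 2 * ρ < ε := by linarith [hk.trans_le (min_le_left _ _)]
  have hρη : 6 * ρ < η := by linarith [hk.trans_le (min_le_right _ _)]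
  choose a ha using fun i => hq.exists_dist_lt (x i) hρ0
  obtain ⟨l, hl⟩ := hf ⟨j, R, v, a, k⟩
  have hGl := hGE l
  simp only [hl] at hGl
  refine hGl ⟨hRd, fun i i' hii' => ?_, fun y hy => hball ?_⟩ x hx (fun i => (ha i).le) hR0
  · have h1 := hηx i i' hii'
    have h2 := dist_triangle4 (x i) (q (a i)) (q (a i')) (x i')
    have h3 := ha i
    have h4 := ha i'
    rw [dist_comm (x i')] at h4
    simp only [← hρ]
    linarith
  · refine lt_of_le_of_lt ((dist_pi_le_iff (by positivity)).mpr fun i => ?_) hρε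
    have h1 : dist (y i) (q (a i)) ≤ ρ := hy i
    linarith [dist_triangle_right (y i) (x i) (q (a i)), ha i]
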